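/- Let $\mathbb{R}_+=[0,\infty)$ and let $\sigma,\alpha\in L^\infty(\mathbb{R}_+)$ be real-valued. For $\varphi\in H^1(\mathbb{R}_+^2)$ (complex-valued) put $$q[\varphi]=\int_{\mathbb{R}_+^2}|\nabla\varphi|^2\,dx\,dy-\int_0^\infty\sigma(y)\left(|\varphi(y,0)|^2+|\varphi(0,y)|^2\right)dy+\int_0^\infty\alpha(y)\,|\varphi(y,y)|^2\,dy ,$$ where $\varphi(\cdot,0)$, $\varphi(0,\cdot)$ and $\varphi(y,y)$ denote the traces of $\varphi$ on the two coordinate half-axes and on the diagonal. The form $q$ with domain $H^1(\mathbb{R}_+^2)$ is closed and bounded from below in $L^2(\mathbb{R}_+^2)$; let $-\Delta^{d=\infty}_{\sigma,\alpha}$ be the self-adjoint operator associated with it, that is, $\varphi$ lies in its domain and is mapped to $f\in L^2(\mathbb{R}_+^2)$ if and only if $\varphi\in H^1(\mathbb{R}_+^2)$ and $q(\varphi,\psi)=\langle f,\psi\rangle$ for all $\psi\in H^1(\mathbb{R}_+^2)$, where $q(\cdot,\cdot)$ is the sesquilinear form of $q[\cdot]$. **Lemma.** If $\sigma$ and $\alpha$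 have bounded (essential) support, then $-\Delta^{d=\infty}_{\sigma,\alpha}$ has only finitely many negative eigenvalues, counted with multiplicity: the set of its eigenvalues $E<0$ is finite, and each of them has a finite-dimensional eigenspace. -/

import Mathlib

open MeasureTheory Filter Topology
open scoped ContDiff ENNReal

namespace HalfLinePair

noncomputable section

/-! ### The configuration space and its Hilbert space -/

/-- The two-particle configuration space `ℝ₊²` (up to its boundary, a null set). -/
def quadrant : Set (ℝ × ℝ) := {p | 0 < p.1 ∧ 0 < p.2}

/-- Lebesgue measure on `ℝ₊²`. -/
abbrev μQ : Measure (ℝ × ℝ) := volume.restrict quadrant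

/-- Lebesgue measure on `ℝ₊`. -/
abbrev μH : Measure ℝ := volume.restrict (Set.Ioi 0)

/-- The two-particle Hilbert space `L²(ℝ₊²)` of complex-valued functions. -/
abbrev L2Quadrant : Type := Lp ℂ 2 μQ

/-- The space `L²(ℝ₊)`, in which boundary values live. -/
abbrev L2HalfLine : Type := Lp ℂ 2 μH

/-- The real space `L^∞(ℝ₊)`, in which the potentials live. -/
abbrev LInftyHalfLine : Type := Lp ℝ ∞ μH

/-- The (essential) support of `σ ∈ L^∞(ℝ₊)` is bounded. -/
def HasBoundedSupport (σ : LInftyHalfLine) : Prop :=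
  ∃ R : ℝ, ∀ᵐ y ∂μH, R < y → σ y = 0

/-! ### Weak derivatives and boundary values -/

/-- `g` is the weak derivative of `φ` on `ℝ₊²` in the direction `e`. -/
def IsWeakDeriv (e : ℝ × ℝ) (φ g : L2Quadrant) : Prop :=
  ∀ θ : ℝ × ℝ → ℝ, ContDiff ℝ ∞ θ → HasCompactSupport θ → tsupport θ ⊆ quadrant →
    ∫ p, (fderiv ℝ θ p e : ℂ) * φ p ∂μQ = - ∫ p, (θ p : ℂ) * g p ∂μQ

/-- `g` is the trace along the curve `y ↦ c y`, `y > 0`, of the `H¹`-function `φ` with weak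
gradient `(d₁, d₂)`: there are `u n ∈ C_c^∞(ℝ²)` whose restrictions to `ℝ₊²` converge to `φ` in
`H¹(ℝ₊²)`, and whose restrictions to the curve converge to `g` in `L²(ℝ₊)`. That is, `g` is the
value at `φ` of the continuous extension to `H¹(ℝ₊²)` of the restriction map
`u ↦ u ∘ c` (for the three curves used below, the trace theorem says that each
`φ ∈ H¹(ℝ₊²)` has exactly one trace). -/
def IsTrace (c : ℝ → ℝ × ℝ) (φ d₁ d₂ : L2Quadrant) (g : L2HalfLine) : Prop :=
  ∃ u : ℕ → ℝ × ℝ → ℂ,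
    (∀ n, ContDiff ℝ ∞ (u n) ∧ HasCompactSupport (u n)) ∧
    Tendsto (fun n => eLpNorm (fun p => u n p - φ p) 2 μQ) atTop (𝓝 0) ∧
    Tendsto (fun n => eLpNorm (fun p => fderiv ℝ (u n) p (1, 0) - d₁ p) 2 μQ) atTop (𝓝 0) ∧
    Tendsto (fun n => eLpNorm (fun p => fderiv ℝ (u n) p (0, 1) - d₂ p) 2 μQ) atTop (𝓝 0) ∧
    Tendsto (fun n => eLpNorm (fun y => u n (c y) - g y) 2 μH) atTop (𝓝 0)

/-- A function `φ ∈ H¹(ℝ₊²)`, recorded together with its weak gradient `(∂₁φ, ∂₂φ)`, its boundary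
values `γ(φ) = (φ(y,0), φ(0,y))` and its trace `φ(y,y)` on the diagonal. All of these are
determined by `φ`. -/
structure H1Function where
  toL2 : L2Quadrant
  d₁ : L2Quadrant
  d₂ : L2Quadrant
  horizontal : L2HalfLine
  vertical : L2HalfLine
  diagonal : L2HalfLine
  isWeakDeriv₁ : IsWeakDeriv (1, 0) toL2 d₁
  isWeakDeriv₂ : IsWeakDeriv (0, 1) toL2 d₂
  isTrace_horizontal : IsTrace (fun y => (y, 0)) toL2 d₁ d₂ horizontal
  isTrace_vertical : IsTrace (fun y => (0, y)) toL2 d₁ d₂ vertical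
  isTrace_diagonal : IsTrace (fun y => (y, y)) toL2 d₁ d₂ diagonal

/-! ### The form -/

/-- The sesquilinear form of multiplication by `w ∈ L^∞(ℝ₊)`, `∫₀^∞ w(y) conj(g(y)) h(y) dy`. -/
def weighted (w : LInftyHalfLine) (g h : L2HalfLine) : ℂ :=
  ∫ y, w y • inner ℂ (g y) (h y) ∂μH

/-- The sesquilinear form (conjugate-linear in the first argument) of the quadratic form
`q[φ] = ∫ |∇φ|² - ∫ σ(y) (|φ(y,0)|² + |φ(0,y)|²) dy + ∫ α(y) |φ(y,y)|² dy` on `H¹(ℝ₊²)`. -/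
def form (σ α : LInftyHalfLine) (F G : H1Function) : ℂ :=
  inner ℂ F.d₁ G.d₁ + inner ℂ F.d₂ G.d₂
    - (weighted σ F.horizontal G.horizontal + weighted σ F.vertical G.vertical)
    + weighted α F.diagonal G.diagonal

/-! ### The vector space structure needed for the graph of the operator -/

lemma integrable_weighted (w : LInftyHalfLine) (g h : L2HalfLine) :
    Integrable (fun y => w y • inner ℂ (g y) (h y)) μH :=
  (L2.integrable_inner (𝕜 := ℂ) g h).smul_of_top_right (Lp.memLp w)

lemma weighted_add (w : LInftyHalfLine) (g g' h : L2HalfLine) :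
    weighted w (g + g') h = weighted w g h + weighted w g' h := by
  unfold weighted
  rw [← integral_add (integrable_weighted w g h) (integrable_weighted w g' h)]
  refine integral_congr_ae ?_
  filter_upwards [Lp.coeFn_add g g'] with y hy
  rw [hy, Pi.add_apply, inner_add_left, smul_add]

lemma weighted_smul (w : LInftyHalfLine) (a : ℂ) (g h : L2HalfLine) :
    weighted w (a • g) h = starRingEnd ℂ a * weighted w g h := by
  unfold weighted
  rw [← integral_const_mul]
  refine integral_congr_ae ?_
  filter_upwards [Lp.coeFn_smul a g] with y hy
  rw [hy, Pi.smul_apply, inner_smul_left, mul_smul_comm]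

lemma integrable_bounded_mul {θ : ℝ × ℝ → ℝ} (hc : Continuous θ) (hs : HasCompactSupport θ)
    (f : L2Quadrant) : Integrable (fun p => (θ p : ℂ) * f p) μQ := by
  have h1 : MemLp (fun p => (θ p : ℂ)) 2 μQ :=
    (Complex.continuous_ofReal.comp hc).memLp_of_hasCompactSupport
      (hs.comp_left (g := ((↑) : ℝ → ℂ)) Complex.ofReal_zero)
  exact MemLp.integrable_mul h1 (Lp.memLp f)

lemma continuous_fderiv_apply_of_smooth {θ : ℝ × ℝ → ℝ} (hθ : ContDiff ℝ ∞ θ) (e : ℝ × ℝ) :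
    Continuous (fun p => fderiv ℝ θ p e) :=
  (hθ.continuous_fderiv (by simp)).clm_apply continuous_const

lemma IsWeakDeriv.add {e : ℝ × ℝ} {φ φ' g g' : L2Quadrant} (h : IsWeakDeriv e φ g)
    (h' : IsWeakDeriv e φ' g') : IsWeakDeriv e (φ + φ') (g + g') := by
  intro θ hθ hs hq
  have hd := continuous_fderiv_apply_of_smooth hθ e
  have hds : HasCompactSupport (fun p => fderiv ℝ θ p e) := hs.fderiv_apply (𝕜 := ℝ) e
  have e1 : ∫ p, (fderiv ℝ θ p e : ℂ) * (φ + φ') p ∂μQ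
      = ∫ p, ((fderiv ℝ θ p e : ℂ) * φ p + (fderiv ℝ θ p e : ℂ) * φ' p) ∂μQ := by
    refine integral_congr_ae ?_
    filter_upwards [Lp.coeFn_add φ φ'] with p hp
    rw [hp, Pi.add_apply, mul_add]
  have e2 : ∫ p, (θ p : ℂ) * (g + g') p ∂μQ
      = ∫ p, ((θ p : ℂ) * g p + (θ p : ℂ) * g' p) ∂μQ := by
    refine integral_congr_ae ?_
    filter_upwards [Lp.coeFn_add g g'] with p hp
    rw [hp, Pi.add_apply, mul_add]
  rw [e1, e2, integral_add (integrable_bounded_mul hd hds φ) (integrable_bounded_mul hd hds φ'),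
    integral_add (integrable_bounded_mul hθ.continuous hs g)
      (integrable_bounded_mul hθ.continuous hs g'), h θ hθ hs hq, h' θ hθ hs hq]
  ring

lemma IsWeakDeriv.smul {e : ℝ × ℝ} {φ g : L2Quadrant} (a : ℂ) (h : IsWeakDeriv e φ g) :
    IsWeakDeriv e (a • φ) (a • g) := by
  intro θ hθ hs hq
  have e1 : ∫ p, (fderiv ℝ θ p e : ℂ) * (a • φ) p ∂μQ
      = ∫ p, a * ((fderiv ℝ θ p e : ℂ) * φ p) ∂μQ := by
    refine integral_congr_ae ?_
    filter_upwards [Lp.coeFn_smul a φ] with p hp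
    rw [hp, Pi.smul_apply, smul_eq_mul]
    ring
  have e2 : ∫ p, (θ p : ℂ) * (a • g) p ∂μQ = ∫ p, a * ((θ p : ℂ) * g p) ∂μQ := by
    refine integral_congr_ae ?_
    filter_upwards [Lp.coeFn_smul a g] with p hp
    rw [hp, Pi.smul_apply, smul_eq_mul]
    ring
  rw [e1, e2, integral_const_mul, integral_const_mul, h θ hθ hs hq]
  ring

section Convergence

variable {X : Type*} [MeasurableSpace X] {μ : Measure X}

lemma tendsto_eLpNorm_add {u v : ℕ → X → ℂ} {f g : Lp ℂ 2 μ}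
    (hu : ∀ n, AEStronglyMeasurable (u n) μ) (hv : ∀ n, AEStronglyMeasurable (v n) μ)
    (h : Tendsto (fun n => eLpNorm (fun x => u n x - f x) 2 μ) atTop (𝓝 0))
    (h' : Tendsto (fun n => eLpNorm (fun x => v n x - g x) 2 μ) atTop (𝓝 0)) :
    Tendsto (fun n => eLpNorm (fun x => (u n x + v n x) - (f + g) x) 2 μ) atTop (𝓝 0) := by
  have hs := h.add h'
  rw [add_zero] at hs
  refine tendsto_of_tendsto_of_tendsto_of_le_of_le tendsto_const_nhds hs (fun _ => zero_le) ?_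
  intro n
  have e : eLpNorm (fun x => (u n x + v n x) - (f + g) x) 2 μ
      = eLpNorm ((fun x => u n x - f x) + (fun x => v n x - g x)) 2 μ := by
    refine eLpNorm_congr_ae ?_
    filter_upwards [Lp.coeFn_add f g] with x hx
    simp only [hx, Pi.add_apply]
    ring
  simp only [e]
  exact eLpNorm_add_le ((hu n).sub (Lp.aestronglyMeasurable f))
    ((hv n).sub (Lp.aestronglyMeasurable g)) (by norm_num)

lemma tendsto_eLpNorm_smul {u : ℕ → X → ℂ} {f : Lp ℂ 2 μ} (a : ℂ)
    (h : Tendsto (fun n => eLpNorm (fun x => u n x - f x) 2 μ) atTop (𝓝 0)) :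
    Tendsto (fun n => eLpNorm (fun x => a * u n x - (a • f) x) 2 μ) atTop (𝓝 0) := by
  have hs := ENNReal.Tendsto.const_mul (a := ‖a‖ₑ) h (Or.inr (by simp))
  rw [mul_zero] at hs
  refine hs.congr (fun n => ?_)
  rw [← eLpNorm_const_smul]
  refine eLpNorm_congr_ae ?_
  filter_upwards [Lp.coeFn_smul a f] with x hx
  simp only [hx, Pi.smul_apply, smul_eq_mul]
  ring

end Convergence

lemma aesm_fderiv {u : ℝ × ℝ → ℂ} (hu : ContDiff ℝ ∞ u) (e : ℝ × ℝ) :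
    AEStronglyMeasurable (fun p => fderiv ℝ u p e) μQ :=
  ((hu.continuous_fderiv (by simp)).clm_apply continuous_const).aestronglyMeasurable

lemma IsTrace.add {c : ℝ → ℝ × ℝ} (hc : Continuous c) {φ d₁ d₂ φ' d₁' d₂' : L2Quadrant}
    {g g' : L2HalfLine} (h : IsTrace c φ d₁ d₂ g) (h' : IsTrace c φ' d₁' d₂' g') :
    IsTrace c (φ + φ') (d₁ + d₁') (d₂ + d₂') (g + g') := by
  obtain ⟨u, hu, h0, h1, h2, h3⟩ := h
  obtain ⟨v, hv, k0, k1, k2, k3⟩ := h'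
  have hf : ∀ n p e, fderiv ℝ (fun p => u n p + v n p) p e
      = fderiv ℝ (u n) p e + fderiv ℝ (v n) p e := by
    intro n p e
    rw [fderiv_fun_add ((hu n).1.differentiable (by simp) p)
      ((hv n).1.differentiable (by simp) p)]
    rfl
  refine ⟨fun n p => u n p + v n p, fun n => ⟨(hu n).1.add (hv n).1, (hu n).2.add (hv n).2⟩,
    ?_, ?_, ?_, ?_⟩
  · exact tendsto_eLpNorm_add (fun n => (hu n).1.continuous.aestronglyMeasurable)
      (fun n => (hv n).1.continuous.aestronglyMeasurable) h0 k0
  · simp only [hf]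
    exact tendsto_eLpNorm_add (fun n => aesm_fderiv (hu n).1 _)
      (fun n => aesm_fderiv (hv n).1 _) h1 k1
  · simp only [hf]
    exact tendsto_eLpNorm_add (fun n => aesm_fderiv (hu n).1 _)
      (fun n => aesm_fderiv (hv n).1 _) h2 k2
  · exact tendsto_eLpNorm_add (fun n => ((hu n).1.continuous.comp hc).aestronglyMeasurable)
      (fun n => ((hv n).1.continuous.comp hc).aestronglyMeasurable) h3 k3

lemma IsTrace.smul {c : ℝ → ℝ × ℝ} {φ d₁ d₂ : L2Quadrant} {g : L2HalfLine} (a : ℂ)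
    (h : IsTrace c φ d₁ d₂ g) : IsTrace c (a • φ) (a • d₁) (a • d₂) (a • g) := by
  obtain ⟨u, hu, h0, h1, h2, h3⟩ := h
  have hf : ∀ n p e, fderiv ℝ (fun p => a * u n p) p e = a * fderiv ℝ (u n) p e := by
    intro n p e
    rw [fderiv_const_mul ((hu n).1.differentiable (by simp) p)]
    rfl
  refine ⟨fun n p => a * u n p, fun n => ⟨contDiff_const.mul (hu n).1, (hu n).2.mul_left⟩,
    tendsto_eLpNorm_smul a h0, ?_, ?_, tendsto_eLpNorm_smul a h3⟩
  · simp only [hf]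
    exact tendsto_eLpNorm_smul a h1
  · simp only [hf]
    exact tendsto_eLpNorm_smul a h2

/-- The class in `L²(μ)` of a continuous compactly supported function. -/
def testToL2 {X : Type*} [TopologicalSpace X] [MeasurableSpace X] [OpensMeasurableSpace X]
    (μ : Measure X) [IsFiniteMeasureOnCompacts μ] (u : X → ℂ) (hu : Continuous u)
    (hs : HasCompactSupport u) : Lp ℂ 2 μ :=
  (hu.memLp_of_hasCompactSupport hs).toLp u

lemma testToL2_coe {X : Type*} [TopologicalSpace X] [MeasurableSpace X] [OpensMeasurableSpace X]
    (μ : Measure X) [IsFiniteMeasureOnCompacts μ] (u : X → ℂ) (hu : Continuous u)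
    (hs : HasCompactSupport u) : testToL2 μ u hu hs =ᵐ[μ] u :=
  MemLp.coeFn_toLp _

lemma continuous_fderiv_test {u : ℝ × ℝ → ℂ} (hu : ContDiff ℝ ∞ u) (e : ℝ × ℝ) :
    Continuous (fun p => fderiv ℝ u p e) :=
  (hu.continuous_fderiv (by simp)).clm_apply continuous_const

lemma isOpen_quadrant : IsOpen quadrant :=
  (isOpen_lt continuous_const continuous_fst).inter (isOpen_lt continuous_const continuous_snd)

lemma isWeakDeriv_test {u : ℝ × ℝ → ℂ} (hu : ContDiff ℝ ∞ u) (hs : HasCompactSupport u)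
    (e : ℝ × ℝ) :
    IsWeakDeriv e (testToL2 μQ u hu.continuous hs)
      (testToL2 μQ (fun p => fderiv ℝ u p e) (continuous_fderiv_test hu e)
        (hs.fderiv_apply (𝕜 := ℝ) e)) := by
  intro θ hθ hθs hq
  have e1 : ∫ p, (fderiv ℝ θ p e : ℂ) * testToL2 μQ u hu.continuous hs p ∂μQ
      = ∫ p, (fderiv ℝ θ p e : ℂ) * u p := by
    rw [← setIntegral_eq_integral_of_forall_compl_eq_zero (s := quadrant)
      (f := fun p => (fderiv ℝ θ p e : ℂ) * u p)]
    · refine integral_congr_ae ?_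
      filter_upwards [testToL2_coe μQ u hu.continuous hs] with p hp
      rw [hp]
    · intro p hp
      have : p ∉ tsupport θ := fun h => hp (hq h)
      have h0 : fderiv ℝ θ p = 0 :=
        image_eq_zero_of_notMem_tsupport (f := fderiv ℝ θ)
          (fun h => this (tsupport_fderiv_subset ℝ h))
      simp [h0]
  have e2 : ∫ p, (θ p : ℂ) * testToL2 μQ (fun p => fderiv ℝ u p e) (continuous_fderiv_test hu e)
        (hs.fderiv_apply (𝕜 := ℝ) e) p ∂μQ = ∫ p, (θ p : ℂ) * fderiv ℝ u p e := by
    rw [← setIntegral_eq_integral_of_forall_compl_eq_zero (s := quadrant)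
      (f := fun p => (θ p : ℂ) * fderiv ℝ u p e)]
    · refine integral_congr_ae ?_
      filter_upwards [testToL2_coe μQ (fun p => fderiv ℝ u p e) (continuous_fderiv_test hu e)
        (hs.fderiv_apply (𝕜 := ℝ) e)] with p hp
      rw [hp]
    · intro p hp
      have : p ∉ tsupport θ := fun h => hp (hq h)
      simp [image_eq_zero_of_notMem_tsupport this]
  rw [e1, e2]
  have key := integral_bilinear_fderiv_right_eq_neg_left_of_integrable (μ := volume)
    (f := θ) (g := u) (v := e) (B := ContinuousLinearMap.lsmul ℝ ℝ (E := ℂ)) ?_ ?_ ?_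
    (fun x _ => hθ.differentiable (by simp) x)
    (fun x _ => hu.differentiable (by simp) x)
  · simp only [ContinuousLinearMap.lsmul_apply, Complex.real_smul] at key
    rw [key, neg_neg]
  all_goals simp only [ContinuousLinearMap.lsmul_apply, Complex.real_smul]
  · exact Continuous.integrable_of_hasCompactSupport
      ((Complex.continuous_ofReal.comp (continuous_fderiv_apply_of_smooth hθ e)).mul
        hu.continuous) hs.mul_left
  · exact Continuous.integrable_of_hasCompactSupport
      ((Complex.continuous_ofReal.comp hθ.continuous).mul (continuous_fderiv_test hu e))
      (hs.fderiv_apply (𝕜 := ℝ) e).mul_left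
  · exact Continuous.integrable_of_hasCompactSupport
      ((Complex.continuous_ofReal.comp hθ.continuous).mul hu.continuous) hs.mul_left

lemma isTrace_test {u : ℝ × ℝ → ℂ} (hu : ContDiff ℝ ∞ u) (hs : HasCompactSupport u)
    {c : ℝ → ℝ × ℝ} (hc : Continuous c) (hcs : HasCompactSupport (fun y => u (c y))) :
    IsTrace c (testToL2 μQ u hu.continuous hs)
      (testToL2 μQ (fun p => fderiv ℝ u p (1, 0)) (continuous_fderiv_test hu _)
        (hs.fderiv_apply (𝕜 := ℝ) _))
      (testToL2 μQ (fun p => fderiv ℝ u p (0, 1)) (continuous_fderiv_test hu _)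
        (hs.fderiv_apply (𝕜 := ℝ) _))
      (testToL2 μH (fun y => u (c y)) (hu.continuous.comp hc) hcs) := by
  have h0 : ∀ {X : Type} [TopologicalSpace X] [MeasurableSpace X] [OpensMeasurableSpace X]
      (μ : Measure X) [IsFiniteMeasureOnCompacts μ] (u : X → ℂ) (hu : Continuous u)
      (hs : HasCompactSupport u),
      Tendsto (fun _ : ℕ => eLpNorm (fun x => u x - testToL2 μ u hu hs x) 2 μ) atTop (𝓝 0) := by
    intro X _ _ _ μ _ u hu hs
    have : eLpNorm (fun x => u x - testToL2 μ u hu hs x) 2 μ = 0 := by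
      rw [← eLpNorm_zero (p := 2) (μ := μ) (ε := ℂ)]
      refine eLpNorm_congr_ae ?_
      filter_upwards [testToL2_coe μ u hu hs] with x hx
      simp [hx]
    rw [this]
    exact tendsto_const_nhds
  exact ⟨fun _ => u, fun _ => ⟨hu, hs⟩, h0 _ _ _ _, h0 _ _ _ _, h0 _ _ _ _, h0 _ _ _ _⟩

lemma isClosedEmbedding_horizontal : IsClosedEmbedding (fun y : ℝ => (y, (0 : ℝ))) :=
  (Isometry.of_dist_eq fun a b => by simp [Prod.dist_eq]).isClosedEmbedding

lemma isClosedEmbedding_vertical : IsClosedEmbedding (fun y : ℝ => ((0 : ℝ), y)) :=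
  (Isometry.of_dist_eq fun a b => by simp [Prod.dist_eq]).isClosedEmbedding

lemma isClosedEmbedding_diagonal : IsClosedEmbedding (fun y : ℝ => (y, y)) :=
  (Isometry.of_dist_eq fun a b => by simp [Prod.dist_eq]).isClosedEmbedding

namespace H1Function

/-- The restriction to `ℝ₊²` of a function in `C_c^∞(ℝ²)`. -/
def ofTest (u : ℝ × ℝ → ℂ) (hu : ContDiff ℝ ∞ u) (hs : HasCompactSupport u) : H1Function where
  toL2 := testToL2 μQ u hu.continuous hs
  d₁ := testToL2 μQ (fun p => fderiv ℝ u p (1, 0)) (continuous_fderiv_test hu _)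
    (hs.fderiv_apply (𝕜 := ℝ) _)
  d₂ := testToL2 μQ (fun p => fderiv ℝ u p (0, 1)) (continuous_fderiv_test hu _)
    (hs.fderiv_apply (𝕜 := ℝ) _)
  horizontal := testToL2 μH (fun y => u (y, 0)) (hu.continuous.comp (by fun_prop))
    (hs.comp_isClosedEmbedding isClosedEmbedding_horizontal)
  vertical := testToL2 μH (fun y => u (0, y)) (hu.continuous.comp (by fun_prop))
    (hs.comp_isClosedEmbedding isClosedEmbedding_vertical)
  diagonal := testToL2 μH (fun y => u (y, y)) (hu.continuous.comp (by fun_prop))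
    (hs.comp_isClosedEmbedding isClosedEmbedding_diagonal)
  isWeakDeriv₁ := isWeakDeriv_test hu hs _
  isWeakDeriv₂ := isWeakDeriv_test hu hs _
  isTrace_horizontal := isTrace_test hu hs (by fun_prop) _
  isTrace_vertical := isTrace_test hu hs (by fun_prop) _
  isTrace_diagonal := isTrace_test hu hs (by fun_prop) _

/-- The sum of two `H¹`-functions. -/
def add (F G : H1Function) : H1Function where
  toL2 := F.toL2 + G.toL2
  d₁ := F.d₁ + G.d₁
  d₂ := F.d₂ + G.d₂
  horizontal := F.horizontal + G.horizontal
  vertical := F.vertical + G.vertical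
  diagonal := F.diagonal + G.diagonal
  isWeakDeriv₁ := F.isWeakDeriv₁.add G.isWeakDeriv₁
  isWeakDeriv₂ := F.isWeakDeriv₂.add G.isWeakDeriv₂
  isTrace_horizontal := F.isTrace_horizontal.add (by fun_prop) G.isTrace_horizontal
  isTrace_vertical := F.isTrace_vertical.add (by fun_prop) G.isTrace_vertical
  isTrace_diagonal := F.isTrace_diagonal.add (by fun_prop) G.isTrace_diagonal

/-- A scalar multiple of an `H¹`-function. -/
def smul (a : ℂ) (F : H1Function) : H1Function where
  toL2 := a • F.toL2
  d₁ := a • F.d₁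
  d₂ := a • F.d₂
  horizontal := a • F.horizontal
  vertical := a • F.vertical
  diagonal := a • F.diagonal
  isWeakDeriv₁ := F.isWeakDeriv₁.smul a
  isWeakDeriv₂ := F.isWeakDeriv₂.smul a
  isTrace_horizontal := F.isTrace_horizontal.smul a
  isTrace_vertical := F.isTrace_vertical.smul a
  isTrace_diagonal := F.isTrace_diagonal.smul a

end H1Function

lemma form_add (σ α : LInftyHalfLine) (F F' G : H1Function) :
    form σ α (F.add F') G = form σ α F G + form σ α F' G := by
  simp only [form, H1Function.add, inner_add_left, weighted_add]
  ring

lemma form_smul (σ α : LInftyHalfLine) (a : ℂ) (F G : H1Function) :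
    form σ α (F.smul a) G = starRingEnd ℂ a * form σ α F G := by
  simp only [form, H1Function.smul, inner_smul_left, weighted_smul]
  ring

/-! ### The operator -/

/-- The graph of the operator associated with the form: `(φ, f)` belongs to it if and only if
`φ ∈ H¹(ℝ₊²)` and `q(φ, ψ) = ⟨f, ψ⟩` for all `ψ ∈ H¹(ℝ₊²)`. -/
def operatorGraph (σ α : LInftyHalfLine) : Submodule ℂ (L2Quadrant × L2Quadrant) where
  carrier := {p | ∃ F : H1Function, F.toL2 = p.1 ∧
    ∀ G : H1Function, form σ α F G = inner ℂ p.2 G.toL2}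
  zero_mem' := by
    refine ⟨H1Function.smul 0 (H1Function.ofTest 0 contDiff_const HasCompactSupport.zero), ?_,
      fun G => ?_⟩
    · simp [H1Function.smul]
    · simp [form_smul]
  add_mem' := by
    rintro p p' ⟨F, hF, h⟩ ⟨F', hF', h'⟩
    refine ⟨F.add F', by simp [H1Function.add, hF, hF'], fun G => ?_⟩
    rw [form_add, h, h', Prod.snd_add, inner_add_left]
  smul_mem' := by
    rintro a p ⟨F, hF, h⟩
    refine ⟨F.smul a, by simp [H1Function.smul, hF], fun G => ?_⟩
    rw [form_smul, h, Prod.smul_snd, inner_smul_left]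

lemma weighted_zero_right (w : LInftyHalfLine) (g h : L2HalfLine) (hh : h =ᵐ[μH] 0) :
    weighted w g h = 0 := by
  unfold weighted
  rw [← integral_zero ℝ ℂ (μ := μH)]
  refine integral_congr_ae ?_
  filter_upwards [hh] with y hy
  simp [hy]

lemma inner_weakDeriv_zero {e : ℝ × ℝ} {d : L2Quadrant} (hd : IsWeakDeriv e 0 d)
    {θ : ℝ × ℝ → ℝ} (hθ : ContDiff ℝ ∞ θ) (hs : HasCompactSupport θ) (hq : tsupport θ ⊆ quadrant)
    {g : L2Quadrant} (hg : g =ᵐ[μQ] fun p => (θ p : ℂ)) : inner ℂ d g = 0 := by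
  have h := hd θ hθ hs hq
  have h0 : ∫ p, (fderiv ℝ θ p e : ℂ) * (0 : L2Quadrant) p ∂μQ = 0 := by
    rw [← integral_zero (ℝ × ℝ) ℂ (μ := μQ)]
    refine integral_congr_ae ?_
    filter_upwards [Lp.coeFn_zero ℂ 2 μQ] with p hp
    rw [hp, Pi.zero_apply, mul_zero]
  rw [h0, zero_eq_neg] at h
  rw [← inner_conj_symm, L2.inner_def]
  have : ∫ p, inner ℂ (g p) (d p) ∂μQ = ∫ p, (θ p : ℂ) * d p ∂μQ := by
    refine integral_congr_ae ?_
    filter_upwards [hg] with p hp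
    simp [hp, mul_comm]
  rw [this, h, map_zero]

/-- The graph is single-valued, so that it is indeed the graph of an operator. -/
lemma operatorGraph_singleValued (σ α : LInftyHalfLine) (p : L2Quadrant × L2Quadrant)
    (hp : p ∈ operatorGraph σ α) (h0 : p.1 = 0) : p.2 = 0 := by
  obtain ⟨F, hF, h⟩ := hp
  rw [h0] at hF
  have hopen : IsOpen (quadrant \ {p : ℝ × ℝ | p.1 = p.2}) :=
    isOpen_quadrant.sdiff (isClosed_eq continuous_fst continuous_snd)
  have hae := hopen.ae_eq_zero_of_integral_contDiff_smul_eq_zero (μ := μQ) (f := p.2)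
    (((Lp.memLp p.2).locallyIntegrable (by norm_num)).locallyIntegrableOn _) ?_
  · have hdiag : volume {p : ℝ × ℝ | p.1 = p.2} = 0 := by
      have hne : LinearMap.eqLocus (LinearMap.fst ℝ ℝ ℝ) (LinearMap.snd ℝ ℝ ℝ) ≠ ⊤ := by
        intro h
        have h1 : ((1, 0) : ℝ × ℝ) ∈
            LinearMap.eqLocus (LinearMap.fst ℝ ℝ ℝ) (LinearMap.snd ℝ ℝ ℝ) := h ▸ trivial
        simp at h1
      exact Measure.addHaar_submodule volume _ hne
    rw [Lp.eq_zero_iff_ae_eq_zero]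
    have h1 : ∀ᵐ x ∂μQ, x ∈ quadrant := ae_restrict_mem isOpen_quadrant.measurableSet
    have h2 : ∀ᵐ x ∂μQ, x ∉ {p : ℝ × ℝ | p.1 = p.2} :=
      ae_restrict_of_ae (measure_eq_zero_iff_ae_notMem.mp hdiag)
    filter_upwards [hae, h1, h2] with x hx hx1 hx2
    exact hx ⟨hx1, hx2⟩
  · intro θ hθ hs hq
    have hu : ContDiff ℝ ∞ (fun p => (θ p : ℂ)) := Complex.ofRealCLM.contDiff.comp hθ
    have hus : HasCompactSupport (fun p => (θ p : ℂ)) :=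
      hs.comp_left (g := ((↑) : ℝ → ℂ)) Complex.ofReal_zero
    have hz : ∀ x, x ∉ quadrant \ {p : ℝ × ℝ | p.1 = p.2} → θ x = 0 := fun x hx =>
      image_eq_zero_of_notMem_tsupport (fun h => hx (hq h))
    have hG := h (H1Function.ofTest _ hu hus)
    have hfd : ∀ e x, fderiv ℝ (fun p => (θ p : ℂ)) x e = ((fderiv ℝ θ x e : ℝ) : ℂ) := by
      intro e x
      have := (Complex.ofRealCLM.hasFDerivAt.comp x
        (hθ.differentiable (by simp) x).hasFDerivAt).fderiv
      have h2 : (fun p => (θ p : ℂ)) = Complex.ofRealCLM ∘ θ := rfl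
      rw [h2, this]
      rfl
    have hq' : ∀ e : ℝ × ℝ, tsupport (fun x => fderiv ℝ θ x e) ⊆ quadrant := fun e =>
      (tsupport_fderiv_apply_subset ℝ e).trans (hq.trans Set.sdiff_subset)
    have hθ' : ∀ e : ℝ × ℝ, ContDiff ℝ ∞ (fun x => fderiv ℝ θ x e) := fun e =>
      (hθ.fderiv_right (by simp)).clm_apply contDiff_const
    have i1 : inner ℂ F.d₁ (H1Function.ofTest _ hu hus).d₁ = 0 :=
      inner_weakDeriv_zero (hF ▸ F.isWeakDeriv₁) (hθ' _) (hs.fderiv_apply (𝕜 := ℝ) _) (hq' _)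
        ((testToL2_coe μQ _ (continuous_fderiv_test hu _) (hus.fderiv_apply (𝕜 := ℝ) _)).trans
          (.of_forall fun x => hfd (1, 0) x))
    have i2 : inner ℂ F.d₂ (H1Function.ofTest _ hu hus).d₂ = 0 :=
      inner_weakDeriv_zero (hF ▸ F.isWeakDeriv₂) (hθ' _) (hs.fderiv_apply (𝕜 := ℝ) _) (hq' _)
        ((testToL2_coe μQ _ (continuous_fderiv_test hu _) (hus.fderiv_apply (𝕜 := ℝ) _)).trans
          (.of_forall fun x => hfd (0, 1) x))
    have i3 : (H1Function.ofTest _ hu hus).horizontal =ᵐ[μH] 0 :=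
      (testToL2_coe μH _ (hu.continuous.comp (by fun_prop))
        (hus.comp_isClosedEmbedding isClosedEmbedding_horizontal)).trans (.of_forall fun y => by
        simp [hz (y, 0) (by simp [quadrant])])
    have i4 : (H1Function.ofTest _ hu hus).vertical =ᵐ[μH] 0 :=
      (testToL2_coe μH _ (hu.continuous.comp (by fun_prop))
        (hus.comp_isClosedEmbedding isClosedEmbedding_vertical)).trans (.of_forall fun y => by
        simp [hz (0, y) (by simp [quadrant])])
    have i5 : (H1Function.ofTest _ hu hus).diagonal =ᵐ[μH] 0 :=
      (testToL2_coe μH _ (hu.continuous.comp (by fun_prop))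
        (hus.comp_isClosedEmbedding isClosedEmbedding_diagonal)).trans (.of_forall fun y => by
        simp [hz (y, y) (by simp)])
    rw [form, i1, i2, weighted_zero_right _ _ _ i3, weighted_zero_right _ _ _ i4,
      weighted_zero_right _ _ _ i5] at hG
    have hG' : inner ℂ (H1Function.ofTest _ hu hus).toL2 p.2 = 0 := by
      rw [← inner_conj_symm, ← hG]
      simp
    rw [← hG', L2.inner_def]
    refine integral_congr_ae ?_
    filter_upwards [testToL2_coe μQ _ hu.continuous hus] with x hx
    have hx' : (H1Function.ofTest _ hu hus).toL2 x = (θ x : ℂ) := hx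
    simp [hx', mul_comm]

/-- The operator `-Δ_{σ,α}^{d=∞}` in `L²(ℝ₊²)`: the self-adjoint operator associated with the
closed, lower semibounded form `q` with form domain `H¹(ℝ₊²)`. -/
def laplacian (σ α : LInftyHalfLine) : L2Quadrant →ₗ.[ℂ] L2Quadrant :=
  (operatorGraph σ α).toLinearPMap

lemma graph_laplacian (σ α : LInftyHalfLine) :
    (laplacian σ α).graph = operatorGraph σ α :=
  (operatorGraph σ α).toLinearPMap_graph_eq fun p => operatorGraph_singleValued σ α p

/-! ### Eigenvalues -/

/-- The eigenspace `ker (A - E)` of an unbounded operator `A`. -/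
def eigenspace {H : Type*} [AddCommGroup H] [Module ℂ H] (A : H →ₗ.[ℂ] H) (E : ℂ) :
    Submodule ℂ H :=
  A.graph.comap (LinearMap.id.prod (E • LinearMap.id))

/-- `φ ∈ ker (A - E)` says that `φ` lies in the domain of `A`, and that `A φ = E φ`. -/
lemma mem_eigenspace {H : Type*} [AddCommGroup H] [Module ℂ H] (A : H →ₗ.[ℂ] H) (E : ℂ) (φ : H) :
    φ ∈ eigenspace A E ↔ ∃ h : φ ∈ A.domain, A ⟨φ, h⟩ = E • φ := by
  simp [eigenspace, LinearPMap.mem_graph_iff]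

/-- `E` is an eigenvalue of the unbounded operator `A`. -/
def IsEigenvalue {H : Type*} [AddCommGroup H] [Module ℂ H] (A : H →ₗ.[ℂ] H) (E : ℂ) : Prop :=
  eigenspace A E ≠ ⊥

end

end HalfLinePair

/-!
If `φ` has mean zero on a square of side `h`, then its trace on an edge or on the diagonal of that
square satisfies `∫ |φ|² ≤ 4 h ∫ |∇φ|²`, the last integral being over the square
(`trace_le_smooth` and its limit `trace_le_of_forall_smooth`): every point `(x, c x)` of the curve
is joined to every point `(s, t)` of the square by a vertical and a horizontal segment, and the
fundamental theorem of calculus is applied on each.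

Since `σ` and `α` have bounded support, only the traces in a bounded square matter. Divide it into
`n × n` cells of side `h`. If all cell means of `φ` vanish, summing over the cells along the two
axes and the diagonal bounds the boundary terms of the form by `4 h (2 ‖σ‖ + ‖α‖) ‖∇φ‖²`, which is
at most `‖∇φ‖²` for small `h`. So the form is nonnegative whenever `n²` linear functionals of `φ`
vanish (`exists_form_nonneg_of_cellIntegrals_eq_zero`).

On the other hand, eigenfunctions for different eigenvalues are orthogonal, so that the form is
negative definite on sums of eigenspaces with negative eigenvalues, and the map that sends `φ` to
its cell integrals is injective on such sums (`eq_zero_of_sum_eigenvectors`). This bounds the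
number of negative eigenvalues and the dimension of each eigenspace by `n²`.
-/

namespace HalfLinePair

/-! ### Two integral inequalities -/

lemma norm_integral_sq_le {X E : Type*} [MeasurableSpace X] {μ : Measure X} [IsFiniteMeasure μ]
    [NormedAddCommGroup E] [NormedSpace ℝ E] {f : X → E} (hf : MemLp f 2 μ) :
    ‖∫ x, f x ∂μ‖ ^ 2 ≤ μ.real Set.univ * ∫ x, ‖f x‖ ^ 2 ∂μ := by
  have h1 : Integrable (fun x => ‖f x‖) μ := (hf.integrable (by norm_num)).norm
  have h2 : Integrable (fun x => ‖f x‖ ^ 2) μ := hf.integrable_norm_pow (by norm_num)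
  set m := μ.real Set.univ
  set I := ∫ x, ‖f x‖ ∂μ
  have hle : ‖∫ x, f x ∂μ‖ ≤ I := norm_integral_le_integral_norm f
  have hsq : ‖∫ x, f x ∂μ‖ ^ 2 ≤ I ^ 2 := by gcongr
  refine hsq.trans ?_
  have hm : 0 ≤ m := measureReal_nonneg
  rcases hm.eq_or_lt with h0 | h0
  · have : μ = 0 := by
      rw [← Measure.measure_univ_eq_zero]
      exact (measureReal_eq_zero_iff (by simp)).1 h0.symm
    simp [I, this]
  -- Cauchy–Schwarz as nonnegativity of the (rescaled) variance of `‖f‖`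
  have key : 0 ≤ ∫ x, (m * ‖f x‖ - I) ^ 2 ∂μ := integral_nonneg fun x => sq_nonneg _
  have e : ∫ x, (m * ‖f x‖ - I) ^ 2 ∂μ
      = m ^ 2 * ∫ x, ‖f x‖ ^ 2 ∂μ - 2 * m * I * I + m * I ^ 2 := by
    have : ∀ x, (m * ‖f x‖ - I) ^ 2 = m ^ 2 * ‖f x‖ ^ 2 - 2 * m * I * ‖f x‖ + I ^ 2 :=
      fun x => by ring
    simp only [this]
    have h3 : Integrable (fun x => m ^ 2 * ‖f x‖ ^ 2 - 2 * m * I * ‖f x‖) μ :=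
      (h2.const_mul _).sub (h1.const_mul _)
    rw [integral_add h3 (integrable_const _), integral_sub (h2.const_mul _) (h1.const_mul _),
      integral_const_mul, integral_const_mul, integral_const, smul_eq_mul]
  rw [e] at key
  have : 0 ≤ m * (m * ∫ x, ‖f x‖ ^ 2 ∂μ - I ^ 2) := by linarith
  linarith [nonneg_of_mul_nonneg_right this h0]

lemma norm_sub_sq_le_integral_deriv {v v' : ℝ → ℂ} (hv : ∀ x, HasDerivAt v (v' x) x)
    (hc : Continuous v') {b h : ℝ} (hh : 0 ≤ h) {x y : ℝ} (hx : x ∈ Set.Icc b (b + h))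
    (hy : y ∈ Set.Icc b (b + h)) :
    ‖v x - v y‖ ^ 2 ≤ h * ∫ t in Set.Ioc b (b + h), ‖v' t‖ ^ 2 := by
  have hFTC : ∫ t in y..x, v' t = v x - v y :=
    intervalIntegral.integral_eq_sub_of_hasDerivAt (fun t _ => hv t) (hc.intervalIntegrable _ _)
  have hsub : Set.uIoc y x ⊆ Set.Ioc b (b + h) := by
    intro t ht
    rw [Set.mem_uIoc] at ht
    rcases ht with ht | ht
    · exact ⟨hy.1.trans_lt ht.1, ht.2.trans hx.2⟩
    · exact ⟨hx.1.trans_lt ht.1, ht.2.trans hy.2⟩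
  have hint : IntegrableOn (fun t => ‖v' t‖) (Set.Ioc b (b + h)) :=
    (hc.norm.integrableOn_Icc).mono_set Set.Ioc_subset_Icc_self
  have h1 : ‖v x - v y‖ ≤ ∫ t in Set.Ioc b (b + h), ‖v' t‖ := by
    rw [← hFTC]
    exact (intervalIntegral.norm_integral_le_integral_norm_uIoc).trans
      (setIntegral_mono_set hint (.of_forall fun _ => norm_nonneg _) hsub.eventuallyLE)
  have h2 := norm_integral_sq_le (μ := volume.restrict (Set.Ioc b (b + h)))
    (f := fun t => ‖v' t‖) (by
      rw [memLp_two_iff_integrable_sq_norm hc.norm.aestronglyMeasurable]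
      exact (by fun_prop : Continuous fun t => ‖‖v' t‖‖ ^ 2).integrableOn_Icc.mono_set
        Set.Ioc_subset_Icc_self)
  have hm : (volume.restrict (Set.Ioc b (b + h))).real Set.univ = h := by
    simp [hh]
  rw [hm] at h2
  simp only [Real.norm_eq_abs, sq_abs] at h2
  exact (pow_le_pow_left₀ (norm_nonneg _) h1 2).trans h2

/-! ### The trace inequality on a square for smooth functions -/

/-- The half-open square of side `h` with lower left corner `(a, b)`. -/
def box (a b h : ℝ) : Set (ℝ × ℝ) := Set.Ioc a (a + h) ×ˢ Set.Ioc b (b + h)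

lemma measurableSet_box (a b h : ℝ) : MeasurableSet (box a b h) :=
  measurableSet_Ioc.prod measurableSet_Ioc

lemma volume_real_box (a b : ℝ) {h : ℝ} (hh : 0 ≤ h) : volume.real (box a b h) = h ^ 2 := by
  rw [box, Measure.volume_eq_prod, measureReal_prod_prod]
  simp [hh, sq]

lemma integrableOn_box {E : Type*} [NormedAddCommGroup E] {f : ℝ × ℝ → E} (hf : Continuous f)
    (a b h : ℝ) : IntegrableOn f (box a b h) :=
  (hf.continuousOn.integrableOn_compact (isCompact_Icc.prod isCompact_Icc)).mono_set
    (Set.prod_mono Set.Ioc_subset_Icc_self Set.Ioc_subset_Icc_self)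

lemma volume_box_ne_top (a b h : ℝ) : volume (box a b h) ≠ ⊤ := by
  rw [box, Measure.volume_eq_prod, Measure.prod_prod]
  exact ENNReal.mul_ne_top (by simp) (by simp)

/-- The trace inequality on a square of side `h`, along a curve that is a graph over the first
coordinate: up to the mean of `u` over the square, the trace is controlled by the gradient, with a
constant proportional to `h`. Both an edge and the diagonal are such graphs. -/
lemma trace_le_smooth {u u₁ u₂ : ℝ × ℝ → ℂ} (hu : Continuous u) (hu₁ : Continuous u₁)
    (hu₂ : Continuous u₂) (hd₁ : ∀ x y, HasDerivAt (fun s => u (s, y)) (u₁ (x, y)) x)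
    (hd₂ : ∀ x y, HasDerivAt (fun t => u (x, t)) (u₂ (x, y)) y)
    {a b h : ℝ} (hh : 0 < h) {c : ℝ → ℝ} (hc : Continuous c)
    (hcm : ∀ x ∈ Set.Ioc a (a + h), c x ∈ Set.Icc b (b + h)) :
    ∫ x in Set.Ioc a (a + h), ‖u (x, c x)‖ ^ 2 ≤
      4 * h * ((∫ p in box a b h, ‖u₁ p‖ ^ 2) + ∫ p in box a b h, ‖u₂ p‖ ^ 2)
        + 2 / h ^ 3 * ‖∫ p in box a b h, u p‖ ^ 2 := by
  set I := Set.Ioc a (a + h)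
  set J := Set.Ioc b (b + h)
  set B := box a b h
  set m := ∫ p in B, u p
  set A : ℝ → ℝ := fun x => ∫ t in J, ‖u₂ (x, t)‖ ^ 2
  set D : ℝ → ℝ := fun t => ∫ s in I, ‖u₁ (s, t)‖ ^ 2
  have hi₁ : IntegrableOn (fun p => ‖u₁ p‖ ^ 2) B := integrableOn_box (by fun_prop) _ _ _
  have hi₂ : IntegrableOn (fun p => ‖u₂ p‖ ^ 2) B := integrableOn_box (by fun_prop) _ _ _
  have hA : IntegrableOn A I := by
    have := hi₂
    rw [IntegrableOn, show B = I ×ˢ J from rfl, Measure.volume_eq_prod,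
      ← Measure.prod_restrict] at this
    exact this.integral_prod_left
  have hD : IntegrableOn D J := by
    have := hi₁
    rw [IntegrableOn, show B = I ×ˢ J from rfl, Measure.volume_eq_prod,
      ← Measure.prod_restrict] at this
    exact this.integral_prod_right
  have hAI : ∫ x in I, A x = ∫ p in B, ‖u₂ p‖ ^ 2 :=
    (setIntegral_prod (fun p : ℝ × ℝ => ‖u₂ p‖ ^ 2) hi₂).symm
  have hDJ : ∫ t in J, D t = ∫ p in B, ‖u₁ p‖ ^ 2 := by
    have := hi₁
    rw [IntegrableOn, show B = I ×ˢ J from rfl, Measure.volume_eq_prod,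
      ← Measure.prod_restrict] at this
    rw [show B = I ×ˢ J from rfl, Measure.volume_eq_prod, ← Measure.prod_restrict,
      integral_prod_symm _ this]
  have hvI : volume.real I = h := by simp [I, hh.le]
  have hvB : volume.real B = h ^ 2 := volume_real_box a b hh.le
  -- the polygonal path from `(x, c x)` to `(x, t)` to `(s, t)`
  have hpt : ∀ x ∈ I, ∀ p ∈ B, ‖u (x, c x) - u p‖ ^ 2 ≤ 2 * h * (A x + D p.2) := by
    rintro x hx ⟨s, t⟩ ⟨hs, ht⟩
    have h1 : ‖u (x, c x) - u (x, t)‖ ^ 2 ≤ h * A x :=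
      norm_sub_sq_le_integral_deriv (fun y => hd₂ x y) (by fun_prop) hh.le (hcm x hx)
        (Set.Ioc_subset_Icc_self ht)
    have h2 : ‖u (x, t) - u (s, t)‖ ^ 2 ≤ h * D t :=
      norm_sub_sq_le_integral_deriv (v := fun s => u (s, t)) (fun y => hd₁ y t) (by fun_prop)
        hh.le (Set.Ioc_subset_Icc_self hx) (Set.Ioc_subset_Icc_self hs)
    have h3 : ‖u (x, c x) - u (s, t)‖ ≤ ‖u (x, c x) - u (x, t)‖ + ‖u (x, t) - u (s, t)‖ :=
      norm_sub_le_norm_sub_add_norm_sub _ _ _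
    have h4 := pow_le_pow_left₀ (norm_nonneg _) h3 2
    have h5 := add_sq_le (a := ‖u (x, c x) - u (x, t)‖) (b := ‖u (x, t) - u (s, t)‖)
    dsimp only
    linarith
  have hDB : IntegrableOn (fun p : ℝ × ℝ => D p.2) B := by
    rw [IntegrableOn, show B = I ×ˢ J from rfl, Measure.volume_eq_prod,
      ← Measure.prod_restrict]
    exact hD.comp_snd _
  have hDBI : ∫ p in B, D p.2 = h * ∫ p in B, ‖u₁ p‖ ^ 2 := by
    have := setIntegral_prod_mul (μ := (volume : Measure ℝ)) (ν := (volume : Measure ℝ))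
      (fun _ : ℝ => (1 : ℝ)) D I J
    rw [← Measure.volume_eq_prod] at this
    simp only [one_mul] at this
    rw [show B = I ×ˢ J from rfl, this, hDJ]
    simp [hvI, B, box, I, J]
  have hav : ∀ x ∈ I, ‖u (x, c x)‖ ^ 2
      ≤ 4 * h * A x + 4 * (∫ p in B, ‖u₁ p‖ ^ 2) + 2 / h ^ 4 * ‖m‖ ^ 2 := by
    intro x hx
    have : IsFiniteMeasure (volume.restrict B) :=
      ⟨by rw [Measure.restrict_apply_univ]; exact (volume_box_ne_top a b h).lt_top⟩
    have h1 := norm_integral_sq_le (μ := volume.restrict B) (f := fun p => u (x, c x) - u p) (by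
      rw [memLp_two_iff_integrable_sq_norm (by fun_prop)]
      exact integrableOn_box (by fun_prop) _ _ _)
    have h2 : ∫ p in B, (u (x, c x) - u p) = (h ^ 2 : ℝ) • u (x, c x) - m := by
      rw [integral_sub (integrable_const _) (integrableOn_box hu _ _ _), integral_const]
      rw [measureReal_restrict_apply_univ, hvB]
    have h3 : ∫ p in B, ‖u (x, c x) - u p‖ ^ 2
        ≤ ∫ p in B, 2 * h * (A x + D p.2) :=
      setIntegral_mono_on (integrableOn_box (by fun_prop) _ _ _)
        (((integrable_const _).add hDB).const_mul _) (measurableSet_box _ _ _) (hpt x hx)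
    rw [integral_const_mul, integral_add (integrable_const _) hDB, integral_const, hDBI] at h3
    rw [h2] at h1
    simp only [measureReal_restrict_apply_univ, hvB, smul_eq_mul] at h1 h3
    have h4 : ‖(h ^ 2 : ℝ) • u (x, c x)‖ ≤ ‖(h ^ 2 : ℝ) • u (x, c x) - m‖ + ‖m‖ := by
      have := norm_add_le ((h ^ 2 : ℝ) • u (x, c x) - m) m
      rwa [sub_add_cancel] at this
    have h5 := pow_le_pow_left₀ (norm_nonneg _) h4 2
    have h6 := add_sq_le (a := ‖(h ^ 2 : ℝ) • u (x, c x) - m‖) (b := ‖m‖)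
    have h7 : h ^ 2 * ∫ p in B, ‖u (x, c x) - u p‖ ^ 2
        ≤ h ^ 2 * (2 * h * (h ^ 2 * A x + h * ∫ p in B, ‖u₁ p‖ ^ 2)) := by gcongr
    rw [norm_smul, mul_pow, Real.norm_eq_abs, sq_abs] at h5
    have h8 : (h ^ 2) ^ 2 * ‖u (x, c x)‖ ^ 2 ≤ (h ^ 2) ^ 2 *
        (4 * h * A x + 4 * (∫ p in B, ‖u₁ p‖ ^ 2) + 2 / h ^ 4 * ‖m‖ ^ 2) := by
      have e : (h ^ 2) ^ 2 * (2 / h ^ 4 * ‖m‖ ^ 2) = 2 * ‖m‖ ^ 2 := by field_simp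
      rw [mul_add, e]
      linarith
    exact le_of_mul_le_mul_left h8 (by positivity)
  have hA' : IntegrableOn (fun x => 4 * h * A x + 4 * ∫ p in B, ‖u₁ p‖ ^ 2) I :=
    (hA.const_mul _).add (integrable_const _)
  calc ∫ x in I, ‖u (x, c x)‖ ^ 2
      ≤ ∫ x in I, (4 * h * A x + 4 * (∫ p in B, ‖u₁ p‖ ^ 2) + 2 / h ^ 4 * ‖m‖ ^ 2) := by
        refine setIntegral_mono_on ?_ ?_ measurableSet_Ioc hav
        · exact (by fun_prop : Continuous fun x => ‖u (x, c x)‖ ^ 2).integrableOn_Icc.mono_set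
            Set.Ioc_subset_Icc_self
        · exact hA'.add (integrable_const _)
    _ = _ := by
        rw [integral_add hA' (integrable_const _),
          integral_add (hA.const_mul _) (integrable_const _), integral_const_mul, hAI,
          integral_const, integral_const, measureReal_restrict_apply_univ, hvI]
        simp only [smul_eq_mul]
        field_simp
        ring

/-- The trace inequality along a curve that is a graph over the second coordinate. -/
lemma trace_le_smooth_swap {u u₁ u₂ : ℝ × ℝ → ℂ} (hu : Continuous u) (hu₁ : Continuous u₁)
    (hu₂ : Continuous u₂) (hd₁ : ∀ x y, HasDerivAt (fun s => u (s, y)) (u₁ (x, y)) x)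
    (hd₂ : ∀ x y, HasDerivAt (fun t => u (x, t)) (u₂ (x, y)) y)
    {a b h : ℝ} (hh : 0 < h) {c : ℝ → ℝ} (hc : Continuous c)
    (hcm : ∀ y ∈ Set.Ioc b (b + h), c y ∈ Set.Icc a (a + h)) :
    ∫ y in Set.Ioc b (b + h), ‖u (c y, y)‖ ^ 2 ≤
      4 * h * ((∫ p in box a b h, ‖u₁ p‖ ^ 2) + ∫ p in box a b h, ‖u₂ p‖ ^ 2)
        + 2 / h ^ 3 * ‖∫ p in box a b h, u p‖ ^ 2 := by
  have hsw : ∀ {E : Type} [NormedAddCommGroup E] [NormedSpace ℝ E] (f : ℝ × ℝ → E),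
      ∫ p in box b a h, f p.swap = ∫ p in box a b h, f p := fun f =>
    setIntegral_prod_swap (μ := volume) (ν := volume) _ _ f
  have key := trace_le_smooth (u := fun p => u p.swap) (u₁ := fun p => u₂ p.swap)
    (u₂ := fun p => u₁ p.swap) (by fun_prop) (by fun_prop) (by fun_prop)
    (fun x y => hd₂ y x) (fun x y => hd₁ y x) hh hc hcm
  rw [hsw u, hsw (fun p => ‖u₁ p‖ ^ 2), hsw (fun p => ‖u₂ p‖ ^ 2)] at key
  rw [add_comm (∫ p in box a b h, ‖u₁ p‖ ^ 2)]
  exact key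

/-! ### Continuity of integrals with respect to `L²`-convergence -/

section

variable {X : Type*} [MeasurableSpace X] {μ : Measure X}

lemma tendsto_toLp_of_tendsto_eLpNorm {u : ℕ → X → ℂ} (hu : ∀ n, MemLp (u n) 2 μ) {f : Lp ℂ 2 μ}
    (h : Tendsto (fun n => eLpNorm (fun x => u n x - f x) 2 μ) atTop (𝓝 0)) :
    Tendsto (fun n => (hu n).toLp (u n)) atTop (𝓝 f) := by
  have := (Lp.tendsto_Lp_iff_tendsto_eLpNorm'' u hu f (Lp.memLp f)).2 h
  rwa [Lp.toLp_coeFn] at this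

lemma norm_sq_eq_integral (f : Lp ℂ 2 μ) : ‖f‖ ^ 2 = ∫ x, ‖f x‖ ^ 2 ∂μ := by
  have h : inner ℂ f f = ((∫ x, ‖f x‖ ^ 2 ∂μ : ℝ) : ℂ) := by
    rw [L2.inner_def, ← integral_complex_ofReal]
    refine integral_congr_ae (.of_forall fun x => ?_)
    simp [inner_self_eq_norm_sq_to_K]
  rw [inner_self_eq_norm_sq_to_K] at h
  exact Complex.ofReal_injective (by simpa using h)

lemma integrable_norm_sq (f : Lp ℂ 2 μ) : Integrable (fun x => ‖f x‖ ^ 2) μ :=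
  (Lp.memLp f).integrable_norm_pow (by norm_num)

lemma continuous_setIntegral_norm_sq (s : Set X) :
    Continuous fun f : Lp ℂ 2 μ => ∫ x in s, ‖f x‖ ^ 2 ∂μ := by
  have : (fun f : Lp ℂ 2 μ => ∫ x in s, ‖f x‖ ^ 2 ∂μ)
      = fun f => ‖LpToLpRestrictCLM X ℂ ℂ μ 2 s f‖ ^ 2 := by
    funext f
    rw [norm_sq_eq_integral]
    refine integral_congr_ae ?_
    filter_upwards [LpToLpRestrictCLM_coeFn ℂ s f] with x hx
    rw [hx]
  rw [this]
  fun_prop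

lemma continuous_setIntegral_L2 {s : Set X} (hs : MeasurableSet s) (hμs : μ s ≠ ⊤) :
    Continuous fun f : Lp ℂ 2 μ => ∫ x in s, f x ∂μ := by
  simp_rw [← L2.inner_indicatorConstLp_one (𝕜 := ℂ) hs hμs]
  fun_prop

end

/-! ### The trace inequality on a cell for `H¹`-functions -/

/-- An inequality bounding the values on a curve by the gradient and the mean on a set `B` passes
from smooth functions to traces of `H¹`-functions, as both sides are continuous under the
convergence in the definition of `IsTrace`. -/
lemma trace_le_of_forall_smooth {c : ℝ → ℝ × ℝ} (hc : IsClosedEmbedding c) {S : Set ℝ}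
    {B : Set (ℝ × ℝ)} (hS : S ⊆ Set.Ioi 0) (hB : B ⊆ quadrant) (hBm : MeasurableSet B)
    (hBv : volume B ≠ ⊤) {K M : ℝ}
    (hsm : ∀ u : ℝ × ℝ → ℂ, ContDiff ℝ ∞ u →
      ∫ y in S, ‖u (c y)‖ ^ 2 ≤ K * ((∫ p in B, ‖fderiv ℝ u p (1, 0)‖ ^ 2)
        + ∫ p in B, ‖fderiv ℝ u p (0, 1)‖ ^ 2) + M * ‖∫ p in B, u p‖ ^ 2)
    {φ d₁ d₂ : L2Quadrant} {g : L2HalfLine} (hg : IsTrace c φ d₁ d₂ g) :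
    ∫ y in S, ‖g y‖ ^ 2 ∂μH ≤ K * ((∫ p in B, ‖d₁ p‖ ^ 2 ∂μQ) + ∫ p in B, ‖d₂ p‖ ^ 2 ∂μQ)
      + M * ‖∫ p in B, φ p ∂μQ‖ ^ 2 := by
  obtain ⟨u, hu, h0, h1, h2, h3⟩ := hg
  have hrB : μQ.restrict B = volume.restrict B := Measure.restrict_restrict_of_subset hB
  have hrS : μH.restrict S = volume.restrict S := Measure.restrict_restrict_of_subset hS
  have m0 : ∀ n, MemLp (u n) 2 μQ := fun n =>
    (hu n).1.continuous.memLp_of_hasCompactSupport (hu n).2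
  have m1 : ∀ n, ∀ e, MemLp (fun p => fderiv ℝ (u n) p e) 2 μQ := fun n e =>
    (continuous_fderiv_test (hu n).1 e).memLp_of_hasCompactSupport
      ((hu n).2.fderiv_apply (𝕜 := ℝ) e)
  have m3 : ∀ n, MemLp (fun y => u n (c y)) 2 μH := fun n =>
    ((hu n).1.continuous.comp hc.continuous).memLp_of_hasCompactSupport
      ((hu n).2.comp_isClosedEmbedding hc)
  have hBv' : μQ B ≠ ⊤ := ne_top_of_le_ne_top hBv (Measure.restrict_apply_le _ _)
  have t0 := ((continuous_setIntegral_L2 hBm hBv').tendsto φ).comp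
    (tendsto_toLp_of_tendsto_eLpNorm m0 h0)
  have t1 := ((continuous_setIntegral_norm_sq B).tendsto d₁).comp
    (tendsto_toLp_of_tendsto_eLpNorm (fun n => m1 n _) h1)
  have t2 := ((continuous_setIntegral_norm_sq B).tendsto d₂).comp
    (tendsto_toLp_of_tendsto_eLpNorm (fun n => m1 n _) h2)
  have t3 := ((continuous_setIntegral_norm_sq S).tendsto g).comp
    (tendsto_toLp_of_tendsto_eLpNorm m3 h3)
  refine le_of_tendsto_of_tendsto' t3
    (((t1.add t2).const_mul K).add ((t0.norm.pow 2).const_mul M)) fun n => ?_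
  have e : ∀ {Y : Type} [MeasurableSpace Y] {μ : Measure Y} (s : Set Y) {v : Y → ℂ}
      (hv : MemLp v 2 μ), ∫ x in s, ‖hv.toLp v x‖ ^ 2 ∂μ = ∫ x in s, ‖v x‖ ^ 2 ∂μ := by
    intro Y _ μ s v hv
    refine integral_congr_ae (ae_restrict_of_ae ?_)
    filter_upwards [hv.coeFn_toLp] with x hx
    rw [hx]
  have e0 : ∫ p in B, (m0 n).toLp (u n) p ∂μQ = ∫ p in B, u n p ∂μQ :=
    integral_congr_ae (ae_restrict_of_ae (m0 n).coeFn_toLp)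
  simp only [Function.comp_apply, e, e0]
  simp only [hrB, hrS]
  exact hsm (u n) (hu n).1

lemma hasDerivAt_fst {u : ℝ × ℝ → ℂ} (hu : ContDiff ℝ ∞ u) (x y : ℝ) :
    HasDerivAt (fun s => u (s, y)) (fderiv ℝ u (x, y) (1, 0)) x :=
  ((hu.differentiable (by simp) (x, y)).hasFDerivAt).comp_hasDerivAt x
    ((hasDerivAt_id x).prodMk (hasDerivAt_const x y))

lemma hasDerivAt_snd {u : ℝ × ℝ → ℂ} (hu : ContDiff ℝ ∞ u) (x y : ℝ) :
    HasDerivAt (fun t => u (x, t)) (fderiv ℝ u (x, y) (0, 1)) y :=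
  ((hu.differentiable (by simp) (x, y)).hasFDerivAt).comp_hasDerivAt y
    ((hasDerivAt_const y x).prodMk (hasDerivAt_id y))

/-! ### Traces along the axes and the diagonal -/

/-- The cell with index `(i, j)` of the square grid of mesh `h`. -/
def cell (h : ℝ) (k : ℕ × ℕ) : Set (ℝ × ℝ) := box (k.1 * h) (k.2 * h) h

lemma cell_subset_quadrant {h : ℝ} (hh : 0 < h) (k : ℕ × ℕ) : cell h k ⊆ quadrant := fun p hp =>
  ⟨(by positivity : (0 : ℝ) ≤ k.1 * h).trans_lt hp.1.1,
    (by positivity : (0 : ℝ) ≤ k.2 * h).trans_lt hp.2.1⟩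

lemma pairwise_disjoint_Ioc_mul {h : ℝ} (hh : 0 < h) :
    Pairwise (Function.onFun Disjoint fun i : ℕ => Set.Ioc (i * h) (i * h + h)) := by
  have hm : Monotone fun i : ℕ => (i * h : ℝ) := fun i j hij => by
    have : (i : ℝ) ≤ j := by exact_mod_cast hij
    dsimp only
    gcongr
  have := hm.pairwise_disjoint_on_Ioc_succ
  simpa [add_mul] using this

lemma pairwise_disjoint_cell {h : ℝ} (hh : 0 < h) :
    Pairwise (Function.onFun Disjoint (cell h)) := by
  intro k l hkl
  rw [Function.onFun, cell, cell, box, box, Set.disjoint_prod]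
  by_cases h1 : k.1 = l.1
  · exact Or.inr (pairwise_disjoint_Ioc_mul hh fun h2 => hkl (Prod.ext h1 h2))
  · exact Or.inl (pairwise_disjoint_Ioc_mul hh h1)

lemma sum_setIntegral_cell_le {h : ℝ} (hh : 0 < h) (d : L2Quadrant) {k : ℕ → ℕ × ℕ}
    (hk : Function.Injective k) (n : ℕ) :
    ∑ i ∈ Finset.range n, ∫ p in cell h (k i), ‖d p‖ ^ 2 ∂μQ ≤ ‖d‖ ^ 2 := by
  rw [← integral_biUnion_finset (s := fun i => cell h (k i)) _ (fun i _ => measurableSet_box _ _ _)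
    (fun i _ j _ hij => pairwise_disjoint_cell hh (hk.ne hij))
    (fun i _ => (integrable_norm_sq d).integrableOn), norm_sq_eq_integral]
  exact setIntegral_le_integral (integrable_norm_sq d) (.of_forall fun _ => by positivity)

lemma setIntegral_Ioc_eq_sum {h : ℝ} (hh : 0 < h) (g : L2HalfLine) (n : ℕ) :
    ∫ y in Set.Ioc 0 (n * h), ‖g y‖ ^ 2 ∂μH
      = ∑ i ∈ Finset.range n, ∫ y in Set.Ioc (i * h) (i * h + h), ‖g y‖ ^ 2 ∂μH := by
  induction n with
  | zero => simp
  | succ n ih =>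
    have e : Set.Ioc 0 (((n + 1 : ℕ) : ℝ) * h)
        = Set.Ioc 0 (n * h) ∪ Set.Ioc (n * h) (n * h + h) := by
      rw [Set.Ioc_union_Ioc_eq_Ioc (by positivity) (by linarith)]
      push_cast
      ring_nf
    rw [Finset.sum_range_succ, ← ih, e, setIntegral_union ?_ measurableSet_Ioc
      (integrable_norm_sq g).integrableOn (integrable_norm_sq g).integrableOn]
    exact Set.Ioc_disjoint_Ioc_of_le le_rfl

/-- Summation of the trace inequality along a curve that runs through the cells
`k 0, k 1, …, k (n - 1)`, for a function with zero mean on each of them. The right-hand side is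
global because these cells are disjoint. -/
lemma trace_le_of_cells {h : ℝ} (hh : 0 < h) {c : ℝ → ℝ × ℝ} (hc : IsClosedEmbedding c)
    {k : ℕ → ℕ × ℕ} (hk : Function.Injective k)
    (hsm : ∀ i : ℕ, ∀ u : ℝ × ℝ → ℂ, ContDiff ℝ ∞ u →
      ∫ y in Set.Ioc (i * h) (i * h + h), ‖u (c y)‖ ^ 2
        ≤ 4 * h * ((∫ p in cell h (k i), ‖fderiv ℝ u p (1, 0)‖ ^ 2)
          + ∫ p in cell h (k i), ‖fderiv ℝ u p (0, 1)‖ ^ 2)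
          + 2 / h ^ 3 * ‖∫ p in cell h (k i), u p‖ ^ 2)
    {φ d₁ d₂ : L2Quadrant} {g : L2HalfLine} (hg : IsTrace c φ d₁ d₂ g) {n : ℕ}
    (h0 : ∀ i < n, ∫ p in cell h (k i), φ p ∂μQ = 0) :
    ∫ y in Set.Ioc 0 (n * h), ‖g y‖ ^ 2 ∂μH ≤ 4 * h * (‖d₁‖ ^ 2 + ‖d₂‖ ^ 2) := by
  rw [setIntegral_Ioc_eq_sum hh]
  have h1 : ∀ i ∈ Finset.range n, ∫ y in Set.Ioc (i * h) (i * h + h), ‖g y‖ ^ 2 ∂μH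
      ≤ 4 * h * ((∫ p in cell h (k i), ‖d₁ p‖ ^ 2 ∂μQ)
        + ∫ p in cell h (k i), ‖d₂ p‖ ^ 2 ∂μQ) := by
    intro i hi
    have := trace_le_of_forall_smooth hc
      (fun y hy => (by positivity : (0 : ℝ) ≤ i * h).trans_lt hy.1)
      (cell_subset_quadrant hh (k i)) (measurableSet_box _ _ _) (volume_box_ne_top _ _ _)
      (hsm i) hg
    simpa [h0 i (Finset.mem_range.1 hi)] using this
  refine (Finset.sum_le_sum h1).trans ?_
  rw [← Finset.mul_sum, Finset.sum_add_distrib]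
  have := sum_setIntegral_cell_le hh d₁ hk n
  have := sum_setIntegral_cell_le hh d₂ hk n
  gcongr

section

variable {h : ℝ} {n : ℕ} {φ d₁ d₂ : L2Quadrant} {g : L2HalfLine}

lemma horizontal_trace_le (hh : 0 < h) (hg : IsTrace (fun y => (y, 0)) φ d₁ d₂ g)
    (h0 : ∀ i < n, ∀ j < n, ∫ p in cell h (i, j), φ p ∂μQ = 0) :
    ∫ y in Set.Ioc 0 (n * h), ‖g y‖ ^ 2 ∂μH ≤ 4 * h * (‖d₁‖ ^ 2 + ‖d₂‖ ^ 2) := by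
  refine trace_le_of_cells hh isClosedEmbedding_horizontal (k := fun i => (i, 0))
    (fun i j hij => (Prod.ext_iff.1 hij).1) (fun i u hu => ?_) hg
    fun i hi => h0 i hi 0 (Nat.zero_lt_of_lt hi)
  refine trace_le_smooth hu.continuous (continuous_fderiv_test hu _) (continuous_fderiv_test hu _)
    (hasDerivAt_fst hu) (hasDerivAt_snd hu) hh continuous_const fun x _ => ?_
  simp [hh.le]

lemma vertical_trace_le (hh : 0 < h) (hg : IsTrace (fun y => (0, y)) φ d₁ d₂ g)
    (h0 : ∀ i < n, ∀ j < n, ∫ p in cell h (i, j), φ p ∂μQ = 0) :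
    ∫ y in Set.Ioc 0 (n * h), ‖g y‖ ^ 2 ∂μH ≤ 4 * h * (‖d₁‖ ^ 2 + ‖d₂‖ ^ 2) := by
  refine trace_le_of_cells hh isClosedEmbedding_vertical (k := fun i => (0, i))
    (fun i j hij => (Prod.ext_iff.1 hij).2) (fun i u hu => ?_) hg
    fun i hi => h0 0 (Nat.zero_lt_of_lt hi) i hi
  refine trace_le_smooth_swap hu.continuous (continuous_fderiv_test hu _)
    (continuous_fderiv_test hu _) (hasDerivAt_fst hu) (hasDerivAt_snd hu) hh continuous_const
    fun x _ => ?_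
  simp [hh.le]

lemma diagonal_trace_le (hh : 0 < h) (hg : IsTrace (fun y => (y, y)) φ d₁ d₂ g)
    (h0 : ∀ i < n, ∀ j < n, ∫ p in cell h (i, j), φ p ∂μQ = 0) :
    ∫ y in Set.Ioc 0 (n * h), ‖g y‖ ^ 2 ∂μH ≤ 4 * h * (‖d₁‖ ^ 2 + ‖d₂‖ ^ 2) := by
  refine trace_le_of_cells hh isClosedEmbedding_diagonal (k := fun i => (i, i))
    (fun i j hij => (Prod.ext_iff.1 hij).1) (fun i u hu => ?_) hg fun i hi => h0 i hi i hi
  exact trace_le_smooth hu.continuous (continuous_fderiv_test hu _) (continuous_fderiv_test hu _)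
    (hasDerivAt_fst hu) (hasDerivAt_snd hu) hh continuous_id
    fun x hx => Set.Ioc_subset_Icc_self hx

end

/-! ### Nonnegativity of the form on functions with zero cell means -/

/-- A boundary term is bounded by the `L²`-norm of the trace on the support of the potential. -/
lemma norm_weighted_self_le {w : LInftyHalfLine} {L : ℝ} (hL : ∀ᵐ y ∂μH, L < y → w y = 0)
    (g : L2HalfLine) : ‖weighted w g g‖ ≤ ‖w‖ * ∫ y in Set.Ioc 0 L, ‖g y‖ ^ 2 ∂μH := by
  rw [← integral_const_mul, ← integral_indicator measurableSet_Ioc]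
  refine norm_integral_le_of_norm_le
    (((integrable_norm_sq g).const_mul _).indicator measurableSet_Ioc) ?_
  have hpos : ∀ᵐ y ∂μH, y ∈ Set.Ioi (0 : ℝ) := ae_restrict_mem measurableSet_Ioi
  have hw : ∀ᵐ y ∂μH, ‖w y‖ ≤ ‖w‖ := by
    filter_upwards [ae_le_eLpNormEssSup (f := w) (μ := μH)] with y hy
    rw [Lp.norm_def, eLpNorm_exponent_top, ← toReal_enorm]
    exact ENNReal.toReal_mono (by simpa using Lp.eLpNorm_ne_top w) hy
  filter_upwards [hL, hpos, hw] with y h1 h2 h3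
  by_cases hy : L < y
  · rw [h1 hy, zero_smul, norm_zero]
    exact Set.indicator_nonneg (fun _ _ => by positivity) _
  · rw [Set.indicator_of_mem (show y ∈ Set.Ioc 0 L from ⟨h2, not_lt.1 hy⟩), norm_smul,
      inner_self_eq_norm_sq_to_K]
    simp only [Complex.coe_algebraMap, norm_pow, Complex.norm_real, norm_norm]
    gcongr

/-- The integrals of an `L²`-function over the cells of an `n × n` grid of mesh `h`. -/
noncomputable def cellIntegrals (h : ℝ) (n : ℕ) : L2Quadrant →ₗ[ℂ] (Fin n × Fin n → ℂ) where
  toFun φ k := ∫ p in cell h (k.1, k.2), φ p ∂μQ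
  map_add' φ ψ := by
    funext k
    have hf : ∀ f : L2Quadrant, IntegrableOn f (cell h (k.1, k.2)) μQ := fun f => by
      have : IsFiniteMeasure (μQ.restrict (cell h (k.1, k.2))) :=
        ⟨by
          rw [Measure.restrict_apply_univ]
          exact (Measure.restrict_apply_le _ _).trans_lt (volume_box_ne_top _ _ _).lt_top⟩
      exact ((Lp.memLp f).restrict _).integrable (by norm_num)
    rw [Pi.add_apply, ← integral_add (hf φ) (hf ψ)]
    exact integral_congr_ae (ae_restrict_of_ae (Lp.coeFn_add φ ψ))
  map_smul' a φ := by
    funext k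
    rw [Pi.smul_apply, RingHom.id_apply, ← integral_smul]
    exact integral_congr_ae (ae_restrict_of_ae (Lp.coeFn_smul a φ))

/-- The form is nonnegative on a subspace of finite codimension in `H¹(ℝ₊²)`, cut out by
functionals that are continuous on `L²(ℝ₊²)`. -/
lemma exists_form_nonneg_of_cellIntegrals_eq_zero {σ α : LInftyHalfLine}
    (hσ : HasBoundedSupport σ) (hα : HasBoundedSupport α) :
    ∃ (h : ℝ) (n : ℕ), ∀ F : H1Function, cellIntegrals h n F.toL2 = 0 →
      0 ≤ (form σ α F F).re := by
  obtain ⟨R, hR⟩ := hσ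
  obtain ⟨R', hR'⟩ := hα
  set C := 2 * ‖σ‖ + ‖α‖
  have hC : 0 ≤ C := by positivity
  -- the three traces cost `4 h C ‖∇φ‖²`, which this mesh makes at most `‖∇φ‖²`
  set h := 1 / (4 * (C + 1))
  have hh : 0 < h := by positivity
  have hCh : C * (4 * h) ≤ 1 := by
    have : C * (4 * h) = C / (C + 1) := by
      simp only [h]
      field_simp
    rw [this, div_le_one (by positivity)]
    linarith
  obtain ⟨n, hn⟩ := exists_nat_ge (max R R' / h)
  rw [div_le_iff₀ hh] at hn
  have hσ' : ∀ᵐ y ∂μH, n * h < y → σ y = 0 := by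
    filter_upwards [hR] with y hy h1
    exact hy (((le_max_left _ _).trans hn).trans_lt h1)
  have hα' : ∀ᵐ y ∂μH, n * h < y → α y = 0 := by
    filter_upwards [hR'] with y hy h1
    exact hy (((le_max_right _ _).trans hn).trans_lt h1)
  refine ⟨h, n, fun F hF => ?_⟩
  have h0 : ∀ i < n, ∀ j < n, ∫ p in cell h (i, j), F.toL2 p ∂μQ = 0 := fun i hi j hj =>
    congrFun hF (⟨i, hi⟩, ⟨j, hj⟩)
  set D := ‖F.d₁‖ ^ 2 + ‖F.d₂‖ ^ 2
  have b1 := norm_weighted_self_le hσ' F.horizontal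
  have b2 := norm_weighted_self_le hσ' F.vertical
  have b3 := norm_weighted_self_le hα' F.diagonal
  have c1 := mul_le_mul_of_nonneg_left
    (horizontal_trace_le hh F.isTrace_horizontal h0) (norm_nonneg σ)
  have c2 := mul_le_mul_of_nonneg_left
    (vertical_trace_le hh F.isTrace_vertical h0) (norm_nonneg σ)
  have c3 := mul_le_mul_of_nonneg_left
    (diagonal_trace_le hh F.isTrace_diagonal h0) (norm_nonneg α)
  have r1 := (abs_le.1 (Complex.abs_re_le_norm (weighted σ F.horizontal F.horizontal))).2
  have r2 := (abs_le.1 (Complex.abs_re_le_norm (weighted σ F.vertical F.vertical))).2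
  have r3 := (abs_le.1 (Complex.abs_re_le_norm (weighted α F.diagonal F.diagonal))).1
  have e : ∀ f : L2Quadrant, (inner ℂ f f).re = ‖f‖ ^ 2 := fun f => by
    rw [inner_self_eq_norm_sq_to_K]
    norm_cast
  have hD : C * (4 * h) * D ≤ 1 * D := by gcongr
  simp only [form, Complex.add_re, Complex.sub_re, e]
  have : C * (4 * h) * D = ‖σ‖ * (4 * h * D) + ‖σ‖ * (4 * h * D) + ‖α‖ * (4 * h * D) := by
    simp only [C]
    ring
  linarith

/-! ### Eigenfunctions with negative eigenvalues -/

lemma weighted_conj (w : LInftyHalfLine) (g h : L2HalfLine) :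
    starRingEnd ℂ (weighted w g h) = weighted w h g := by
  unfold weighted
  rw [← integral_conj]
  simp [Complex.real_smul, mul_comm]

lemma form_conj (σ α : LInftyHalfLine) (F G : H1Function) :
    starRingEnd ℂ (form σ α F G) = form σ α G F := by
  simp only [form, map_add, map_sub, inner_conj_symm, weighted_conj]

lemma inner_operatorGraph_comm {σ α : LInftyHalfLine} {p p' : L2Quadrant × L2Quadrant}
    (hp : p ∈ operatorGraph σ α) (hp' : p' ∈ operatorGraph σ α) :
    inner ℂ p.2 p'.1 = inner ℂ p.1 p'.2 := by
  obtain ⟨F, hF, h⟩ := hp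
  obtain ⟨F', hF', h'⟩ := hp'
  rw [← hF', ← h, ← form_conj, h', hF, inner_conj_symm]

lemma mem_eigenspace_laplacian {σ α : LInftyHalfLine} {E : ℂ} {φ : L2Quadrant} :
    φ ∈ eigenspace (laplacian σ α) E ↔ (φ, E • φ) ∈ operatorGraph σ α := by
  rw [eigenspace, graph_laplacian]
  rfl

lemma inner_eq_zero_of_mem_eigenspace {σ α : LInftyHalfLine} {E E' : ℝ} (hne : E ≠ E')
    {φ φ' : L2Quadrant} (h : φ ∈ eigenspace (laplacian σ α) (E : ℂ))
    (h' : φ' ∈ eigenspace (laplacian σ α) (E' : ℂ)) : inner ℂ φ φ' = 0 := by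
  have key := inner_operatorGraph_comm (mem_eigenspace_laplacian.1 h)
    (mem_eigenspace_laplacian.1 h')
  simp only [inner_smul_left, inner_smul_right, Complex.conj_ofReal] at key
  have : ((E : ℂ) - E') * inner ℂ φ φ' = 0 := by rw [sub_mul, key, sub_self]
  refine (mul_eq_zero.1 this).resolve_left ?_
  exact_mod_cast sub_ne_zero.2 hne

/-- The form is negative definite on a sum of eigenspaces with negative eigenvalues, so that such
a sum meets the kernel of `T` only in `0` when the form is nonnegative there. -/
lemma eq_zero_of_sum_eigenvectors {σ α : LInftyHalfLine} {V : Type*} [AddCommGroup V] [Module ℂ V]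
    {T : L2Quadrant →ₗ[ℂ] V} (hT : ∀ F : H1Function, T F.toL2 = 0 → 0 ≤ (form σ α F F).re)
    {ι : Type*} [Fintype ι] {E : ι → ℝ} (hE : Function.Injective E) (hneg : ∀ i, E i < 0)
    {φ : ι → L2Quadrant} (hφ : ∀ i, φ i ∈ eigenspace (laplacian σ α) (E i : ℂ))
    (h0 : T (∑ i, φ i) = 0) (i : ι) : φ i = 0 := by
  have hmem : ∑ i, (φ i, (E i : ℂ) • φ i) ∈ operatorGraph σ α :=
    sum_mem fun i _ => mem_eigenspace_laplacian.1 (hφ i)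
  obtain ⟨F, hF, h⟩ := hmem
  rw [Prod.fst_sum] at hF
  have h1 := hT F (by rw [hF, h0])
  rw [h, hF, Prod.snd_sum, sum_inner, Complex.re_sum] at h1
  have h2 : ∀ i, (inner ℂ ((E i : ℂ) • φ i) (∑ j, φ j)).re = E i * ‖φ i‖ ^ 2 := by
    intro i
    rw [inner_smul_left, inner_sum, Finset.sum_eq_single_of_mem i (Finset.mem_univ i)
      fun j _ hne => inner_eq_zero_of_mem_eigenspace (hE.ne hne.symm) (hφ i) (hφ j),
      inner_self_eq_norm_sq_to_K, Complex.conj_ofReal]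
    simp [← Complex.ofReal_pow]
  rw [Finset.sum_congr rfl fun i _ => h2 i] at h1
  have h3 : ∀ i ∈ Finset.univ, E i * ‖φ i‖ ^ 2 ≤ 0 := fun i _ =>
    mul_nonpos_of_nonpos_of_nonneg (hneg i).le (sq_nonneg _)
  have h4 := (Finset.sum_eq_zero_iff_of_nonpos h3).1 (le_antisymm (Finset.sum_nonpos h3) h1)
  simpa [(hneg i).ne] using h4 i (Finset.mem_univ i)

end HalfLinePair

open HalfLinePair in
theorem mainTheorem12 (σ α : HalfLinePair.LInftyHalfLine)
    (hσ : HalfLinePair.HasBoundedSupport σ) (hα : HalfLinePair.HasBoundedSupport α) :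
    {E : ℝ | E < 0 ∧ HalfLinePair.IsEigenvalue (HalfLinePair.laplacian σ α) (E : ℂ)}.Finite ∧
      ∀ E : ℝ, E < 0 →
        FiniteDimensional ℂ (HalfLinePair.eigenspace (HalfLinePair.laplacian σ α) (E : ℂ)) := by
  obtain ⟨h, n, hT⟩ := exists_form_nonneg_of_cellIntegrals_eq_zero hσ hα
  constructor
  · by_contra hinf
    obtain ⟨s, hs, hcard⟩ := Set.Infinite.exists_subset_card_eq hinf (n * n + 1)
    choose φ hφ hφ0 using fun E : s => Submodule.exists_mem_ne_zero_of_ne_bot (hs E.2).2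
    have hli : LinearIndependent ℂ fun E : s => cellIntegrals h n (φ E) := by
      rw [Fintype.linearIndependent_iff]
      intro a ha E
      have := eq_zero_of_sum_eigenvectors hT Subtype.val_injective (fun E : s => (hs E.2).1)
        (fun E => Submodule.smul_mem _ (a E) (hφ E)) (by simpa using ha) E
      exact (smul_eq_zero.1 this).resolve_right (hφ0 E)
    have := hli.fintype_card_le_finrank
    simp [hcard] at this
  · intro E hE
    refine FiniteDimensional.of_injective
      ((cellIntegrals h n).comp (eigenspace (laplacian σ α) (E : ℂ)).subtype) ?_
    rw [← LinearMap.ker_eq_bot, LinearMap.ker_eq_bot']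
    intro φ hφ
    have := eq_zero_of_sum_eigenvectors hT (E := fun _ : Unit => E)
      (Function.injective_of_subsingleton _) (fun _ => hE) (fun _ => φ.2) (by simpa using hφ) ()
    exact_mod_cast this
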